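/- Let $G$ be a finite simple graph with vertex set $V=\{1,\dots,n\}$, let $K$ be a field, and let $R=K[x_1,\dots,x_n]$ with the standard grading. Let $$J(G)=\Big(\prod_{i\in C}x_i \;\Big|\; C \text{ a minimal vertex cover of } G\Big)\subseteq R$$ be the cover ideal of $G$. For an ideal $I\subseteq R$ and $k\ge 0$ let $I^{(k)}$ denote the $k$-th symbolic power, in either of the two usual senses $$I^{(k)}=\bigcap_{P\in\operatorname{Ass}(R/I)}\big(I^kR_P\cap R\big)\qquad\text{or}\qquad I^{(k)}=\bigcap_{P\in\operatorname{Min}(I)}\big(I^kR_P\cap R\big).$$ For a proper graded ideal $I$ let $$\operatorname{v}(I)=\min\{d\ge 0 \mid \text{there are } f\in R_d \text{ and } \mathfrak p\in\operatorname{Ass}(R/I) \text{ with } I:f=\mathfrak p\},$$ put $\operatorname{v}(R)=0$ by convention, and for a nonzero graded ideal $I$ let $\alpha(I)=\min\{d\mid I_d\neq 0\}$. Then, for both definitions of the symbolic powers, $$\lim_{k\to\infty}\frac{\operatorname{v}(J(G)^{(k)})}{k}=\frac{\alpha(J(G)^{(2)})}{2}.$$ Moreover, if $G$ has at least one edge,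 then for every $k\ge 1$ the set of degrees defining $\operatorname{v}(J(G)^{(k)})$ is nonempty, so that this v-number is a genuine minimum. -/

import Mathlib

open Filter Topology

/-- The `k`-th symbolic power `⋂_{P ∈ Ass(R/I)} (I ^ k R_P ∩ R)` of an ideal `I` of a
Noetherian ring `R`, taken over all associated primes of `I`. -/
noncomputable def Ideal.symbolicPowerAss {R : Type*} [CommRing R] (I : Ideal R) (k : ℕ) :
    Ideal R :=
  ⨅ (P : PrimeSpectrum R) (_ : P.asIdeal ∈ associatedPrimes R (R ⧸ I)),
    ((I ^ k).map (algebraMap R (Localization.AtPrime P.asIdeal))).comap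
      (algebraMap R (Localization.AtPrime P.asIdeal))

/-- The `k`-th symbolic power `⋂_{P ∈ Min(I)} (I ^ k R_P ∩ R)` of an ideal `I` of a
Noetherian ring `R`, taken over the minimal primes of `I` only. -/
noncomputable def Ideal.symbolicPowerMin {R : Type*} [CommRing R] (I : Ideal R) (k : ℕ) :
    Ideal R :=
  ⨅ (P : PrimeSpectrum R) (_ : P.asIdeal ∈ I.minimalPrimes),
    ((I ^ k).map (algebraMap R (Localization.AtPrime P.asIdeal))).comap
      (algebraMap R (Localization.AtPrime P.asIdeal))

namespace MvPolynomial

variable {σ K : Type*} [Field K]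

/-- The degrees `d` for which some form `f` of degree `d` has `I : f` equal to an associated
prime of `I`. -/
def vDegrees (I : Ideal (MvPolynomial σ K)) : Set ℕ :=
  {d | ∃ f : MvPolynomial σ K, f.IsHomogeneous d ∧
    ∃ p ∈ associatedPrimes (MvPolynomial σ K) (MvPolynomial σ K ⧸ I), I.colon {f} = p}

/-- The v-number of a proper graded ideal `I`: the least element of `vDegrees I`
(for the unit ideal `vDegrees I` is empty and the value is `0` by convention). -/
noncomputable def vNumber (I : Ideal (MvPolynomial σ K)) : ℕ := sInf (vDegrees I)

/-- `α(I) = min {d | I_d ≠ 0}`, for a nonzero graded ideal `I`. -/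
noncomputable def initialDegree (I : Ideal (MvPolynomial σ K)) : ℕ :=
  sInf {d | ∃ f ∈ I, f ≠ 0 ∧ f.IsHomogeneous d}

end MvPolynomial

/-- The cover ideal of `G` over `K`: the ideal of `K[x_i : i ∈ V]` generated by the monomials
`∏ i ∈ C, x_i` for `C` a minimal vertex cover of `G`. -/
noncomputable def SimpleGraph.coverIdeal {V : Type*} (K : Type*) [Field K] (G : SimpleGraph V) :
    Ideal (MvPolynomial V K) :=
  Ideal.span {m | ∃ C : Finset V, Minimal (fun D : Finset V => G.IsVertexCover (D : Set V)) C ∧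
    m = ∏ i ∈ C, MvPolynomial.X i}

/-! The associated primes of the cover ideal `J` are the ideals `(x_i, x_j)`, one per edge, all
minimal. So both symbolic powers are the intersection of the `(x_i, x_j)^k`, spanned by the
`k`-covers (`symbolicPowerAss_coverIdeal`), and everything becomes a count of exponents. Put `α =
α(J^(2))` and `n = |V|`. Lower bound: if `J^(k) : f` is prime, it contains a variable, so `α(J^(k))
≤ deg f + 1`; splitting `2m`-covers into `2`-covers gives `kα ≤ 2 α(J^(k))`. Upper bound: a
`2`-cover `a` of least degree has an edge `ij` with `a i + a j = 2`. Adding to `m • a` a bounded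
vector deficient by one on `ij` only gives a monomial whose colon is `(x_i, x_j)`. Hence `v(J^(k))`
differs from `kα/2` by a bounded amount. -/

namespace MvPolynomial

variable {σ K : Type*} [Field K]

/-! ### Weights and the ideals `(x_i, x_j)^k` -/

section Weight

variable [Fintype σ]

/-- The `K`-algebra homomorphism sending `x_l` to `x_l t ^ (w l)`. -/
noncomputable def weightHom (K : Type*) [Field K] (w : σ → ℕ) :
    MvPolynomial σ K →ₐ[K] Polynomial (MvPolynomial σ K) :=
  aeval fun l => Polynomial.C (X l) * Polynomial.X ^ w l

theorem weightHom_monomial (w : σ → ℕ) (a : σ →₀ ℕ) (c : K) :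
    weightHom K w (monomial a c) =
      Polynomial.C (monomial a c) * Polynomial.X ^ (∑ l, w l * a l) := by
  rw [weightHom, aeval_monomial, monomial_eq, Finsupp.prod_fintype _ _ (by simp),
    Finsupp.prod_fintype _ _ (by simp)]
  simp only [mul_pow, Finset.prod_mul_distrib, map_mul, map_prod, map_pow, ← pow_mul,
    Finset.prod_pow_eq_pow_sum, mul_assoc]
  rfl

theorem coeff_coeff_weightHom (w : σ → ℕ) (f : MvPolynomial σ K) (a : σ →₀ ℕ) (d : ℕ) :
    coeff a ((weightHom K w f).coeff d) = if d = ∑ l, w l * a l then coeff a f else 0 := by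
  classical
  induction f using MvPolynomial.induction_on' with
  | monomial b c =>
    rw [weightHom_monomial, Polynomial.coeff_C_mul, Polynomial.coeff_X_pow]
    by_cases h : b = a
    · subst h
      split_ifs <;> simp
    · split_ifs <;> simp [coeff_monomial, h]
  | add p q hp hq =>
    rw [map_add, Polynomial.coeff_add, coeff_add, hp, hq]
    split_ifs <;> simp

theorem X_pow_dvd_weightHom_iff (w : σ → ℕ) (f : MvPolynomial σ K) (k : ℕ) :
    Polynomial.X ^ k ∣ weightHom K w f ↔ ∀ a ∈ f.support, k ≤ ∑ l, w l * a l := by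
  rw [Polynomial.X_pow_dvd_iff]
  constructor
  · intro h a ha
    by_contra! hlt
    have := coeff_coeff_weightHom w f a (∑ l, w l * a l)
    rw [h _ hlt, if_pos rfl, coeff_zero] at this
    exact (mem_support_iff.mp ha) this.symm
  · intro h d hd
    ext a
    rw [coeff_coeff_weightHom, coeff_zero]
    split_ifs with h1
    · by_contra h2
      exact absurd (h a (mem_support_iff.mpr h2)) (by omega)
    · rfl

end Weight

/-- The polynomials all of whose monomials `x ^ a` satisfy `k ≤ a i + a j`; for `i ≠ j` this is
`(x_i, x_j) ^ k`. -/
noncomputable def edgeIdeal (K : Type*) [Field K] (i j : σ) (k : ℕ) : Ideal (MvPolynomial σ K) :=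
  (Ideal.span {Polynomial.X ^ k}).comap (weightHom K (Finsupp.single i 1 + Finsupp.single j 1 : σ →₀ ℕ))

theorem mem_edgeIdeal [Fintype σ] {i j : σ} {k : ℕ} {f : MvPolynomial σ K} :
    f ∈ edgeIdeal K i j k ↔ ∀ a ∈ f.support, k ≤ a i + a j := by
  classical
  rw [edgeIdeal, Ideal.mem_comap, Ideal.mem_span_singleton, X_pow_dvd_weightHom_iff]
  simp [add_mul, Finset.sum_add_distrib, Finsupp.single_apply]

theorem edgeIdeal_comm [Fintype σ] (i j : σ) (k : ℕ) : edgeIdeal K i j k = edgeIdeal K j i k := by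
  ext f
  simp [mem_edgeIdeal, add_comm]

theorem X_mem_edgeIdeal [Fintype σ] {i j l : σ} : (X l : MvPolynomial σ K) ∈ edgeIdeal K i j 1 ↔
    l = i ∨ l = j := by
  classical
  rw [mem_edgeIdeal]
  simp [support_X, Finsupp.single_apply]
  grind

/-- The ideal `(x_i, x_j)^k` is primary: membership is divisibility by `t ^ k` after the weight map,
and `t` is prime. -/
theorem mem_of_mul_mem_edgeIdeal {i j : σ} {k : ℕ} {s f : MvPolynomial σ K}
    (hs : s ∉ edgeIdeal K i j 1) (h : s * f ∈ edgeIdeal K i j k) : f ∈ edgeIdeal K i j k := by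
  rw [edgeIdeal, Ideal.mem_comap, Ideal.mem_span_singleton] at h hs ⊢
  rw [pow_one] at hs
  rw [map_mul] at h
  exact Polynomial.prime_X.pow_dvd_of_dvd_mul_left _ hs h

theorem isPrime_edgeIdeal_one (i j : σ) : (edgeIdeal K i j 1).IsPrime := by
  have : (Ideal.span {(Polynomial.X : Polynomial (MvPolynomial σ K)) ^ 1}).IsPrime := by
    rw [pow_one, Ideal.span_singleton_prime Polynomial.X_ne_zero]
    exact Polynomial.prime_X
  exact Ideal.comap_isPrime _ _

theorem edgeIdeal_one_pow_le (i j : σ) (k : ℕ) : edgeIdeal K i j 1 ^ k ≤ edgeIdeal K i j k := by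
  refine (Ideal.le_comap_pow _ _).trans (Ideal.comap_mono ?_)
  rw [Ideal.span_singleton_pow, pow_one]

/-- An ideal containing every monomial of `f` contains `f`. -/
theorem mem_of_forall_monomial_mem {I : Ideal (MvPolynomial σ K)} {f : MvPolynomial σ K}
    (h : ∀ a ∈ f.support, monomial a 1 ∈ I) : f ∈ I := by
  rw [f.as_sum]
  refine Ideal.sum_mem _ fun a ha => ?_
  have : monomial a (coeff a f) = C (coeff a f) * monomial a 1 := by simp [C_mul_monomial]
  rw [this]
  exact Ideal.mul_mem_left _ _ (h a ha)

/-- The map `φ` allows use both in the polynomial ring and in a localization. -/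
theorem monomial_mem_pow_of_X_mem [Fintype σ] {S : Type*} [CommRing S] {I : Ideal S}
    (φ : MvPolynomial σ K →+* S) {i j : σ} (hij : i ≠ j) (hi : φ (X i) ∈ I) (hj : φ (X j) ∈ I)
    {a : σ →₀ ℕ} {k : ℕ} (h : k ≤ a i + a j) : φ (monomial a 1) ∈ I ^ k := by
  classical
  rw [monomial_eq, Finsupp.prod_fintype _ _ (by simp), map_one, one_mul, map_prod,
    ← Finset.mul_prod_erase _ _ (Finset.mem_univ i),
    ← Finset.mul_prod_erase _ _ (Finset.mem_erase.mpr ⟨hij.symm, Finset.mem_univ j⟩), ← mul_assoc]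
  refine Ideal.mul_mem_right _ _ (Ideal.pow_le_pow_right h ?_)
  rw [pow_add, map_pow, map_pow]
  exact Ideal.mul_mem_mul (Ideal.pow_mem_pow hi _) (Ideal.pow_mem_pow hj _)

theorem edgeIdeal_one_le [Fintype σ] {I : Ideal (MvPolynomial σ K)} {i j : σ} (hij : i ≠ j) (hi : X i ∈ I)
    (hj : X j ∈ I) : edgeIdeal K i j 1 ≤ I := fun f hf =>
  mem_of_forall_monomial_mem fun a ha => by
    simpa using monomial_mem_pow_of_X_mem (RingHom.id _) hij hi hj (mem_edgeIdeal.mp hf a ha)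

end MvPolynomial

theorem Ideal.mem_associatedPrimes_quotient_iff {R : Type*} [CommRing R] [IsNoetherianRing R]
    {I P : Ideal R} : P ∈ associatedPrimes R (R ⧸ I) ↔ P.IsPrime ∧ ∃ f, P = I.colon {f} := by
  have key (f : R) : (⊥ : Submodule R (R ⧸ I)).colon {Ideal.Quotient.mk I f} = I.colon {f} := by
    ext r
    rw [Submodule.mem_colon_singleton, Submodule.mem_colon_singleton, Submodule.mem_bot,
      ← Ideal.Quotient.eq_zero_iff_mem]
    rfl
  refine (Submodule.isAssociatedPrime_iff).trans (and_congr_right fun _ => ?_)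
  rw [(Ideal.Quotient.mk_surjective (I := I)).exists]
  simp only [key]

/-! ### Multicovers and the cover ideal -/

namespace SimpleGraph

open MvPolynomial

variable {V K : Type*} [Field K] {G : SimpleGraph V}

/-- An exponent vector `a` is a `k`-cover of `G` if `k ≤ a i + a j` for every edge `ij`. -/
def IsMultiCover (G : SimpleGraph V) (k : ℕ) (a : V →₀ ℕ) : Prop :=
  ∀ ⦃i j⦄, G.Adj i j → k ≤ a i + a j

/-- The monomial ideal spanned by the `x ^ a` with `a` a `k`-cover of `G`. -/
noncomputable def multiCoverIdeal (K : Type*) [Field K] (G : SimpleGraph V) (k : ℕ) :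
    Ideal (MvPolynomial V K) :=
  ⨅ (i : V) (j : V) (_ : G.Adj i j), edgeIdeal K i j k

theorem mem_multiCoverIdeal_iff_forall_adj {k : ℕ} {f : MvPolynomial V K} :
    f ∈ G.multiCoverIdeal K k ↔ ∀ i j, G.Adj i j → f ∈ edgeIdeal K i j k := by
  simp only [multiCoverIdeal, Submodule.mem_iInf]

theorem multiCoverIdeal_le {i j : V} (h : G.Adj i j) (k : ℕ) :
    G.multiCoverIdeal K k ≤ edgeIdeal K i j k := fun _ hf =>
  mem_multiCoverIdeal_iff_forall_adj.mp hf i j h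

theorem mem_multiCoverIdeal [Fintype V] {k : ℕ} {f : MvPolynomial V K} :
    f ∈ G.multiCoverIdeal K k ↔ ∀ a ∈ f.support, G.IsMultiCover k a := by
  simp only [mem_multiCoverIdeal_iff_forall_adj, mem_edgeIdeal, IsMultiCover]
  grind

theorem monomial_mem_multiCoverIdeal [Fintype V] {k : ℕ} {a : V →₀ ℕ} :
    monomial a 1 ∈ G.multiCoverIdeal K k ↔ G.IsMultiCover k a := by
  classical
  rw [mem_multiCoverIdeal, support_monomial, if_neg one_ne_zero]
  simp

theorem prod_X_mem_coverIdeal [Finite V] {S : Finset V} (hS : G.IsVertexCover (S : Set V)) :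
    ∏ i ∈ S, X i ∈ G.coverIdeal K := by
  obtain ⟨D, hDS, hD⟩ := exists_minimal_le_of_wellFoundedLT
    (fun D : Finset V => G.IsVertexCover (D : Set V)) S hS
  exact Ideal.mem_of_dvd _ (Finset.prod_dvd_prod_of_subset _ _ _ hDS)
    (Ideal.subset_span ⟨D, hD, rfl⟩)

theorem coverIdeal_eq_multiCoverIdeal_one [Fintype V] :
    G.coverIdeal K = G.multiCoverIdeal K 1 := by
  classical
  refine le_antisymm (Ideal.span_le.mpr ?_) fun f hf => mem_of_forall_monomial_mem fun a ha => ?_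
  · rintro _ ⟨C, hC, rfl⟩
    refine mem_multiCoverIdeal_iff_forall_adj.mpr fun i j hij => ?_
    rcases hC.prop hij with h | h
    · exact Ideal.mem_of_dvd _ (Finset.dvd_prod_of_mem _ h) (X_mem_edgeIdeal.mpr (.inl rfl))
    · exact Ideal.mem_of_dvd _ (Finset.dvd_prod_of_mem _ h) (X_mem_edgeIdeal.mpr (.inr rfl))
  · have hcov : G.IsVertexCover (a.support : Set V) := fun i j hij => by
      have := mem_multiCoverIdeal.mp hf a ha hij
      simp only [Finset.mem_coe, Finsupp.mem_support_iff]
      omega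
    refine Ideal.mem_of_dvd _ ?_ (prod_X_mem_coverIdeal hcov)
    rw [monomial_eq, map_one, one_mul]
    exact Finset.prod_dvd_prod_of_dvd _ _ fun i hi =>
      dvd_pow_self _ (Finsupp.mem_support_iff.mp hi)

/-- Otherwise the variables outside `P` form a vertex cover, whose product lies in `J ≤ P` although
no factor does. -/
theorem exists_adj_edgeIdeal_one_le [Fintype V] {P : Ideal (MvPolynomial V K)} (hP : P.IsPrime)
    (h : G.coverIdeal K ≤ P) : ∃ i j, G.Adj i j ∧ edgeIdeal K i j 1 ≤ P := by
  classical
  by_contra! hno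
  have hcov : G.IsVertexCover ((Finset.univ.filter fun i => (X i : MvPolynomial V K) ∉ P :
      Finset V) : Set V) := fun i j hij => by
    by_contra! hc
    simp only [Finset.coe_filter, Finset.mem_univ, true_and, Set.mem_ofPred_eq, not_not] at hc
    exact hno i j hij (edgeIdeal_one_le hij.ne hc.1 hc.2)
  obtain ⟨i, hi, hiP⟩ := hP.prod_mem_iff.mp (h (prod_X_mem_coverIdeal hcov))
  exact (Finset.mem_filter.mp hi).2 hiP

theorem edgeIdeal_one_eq_of_le [Fintype V] {i j u v : V} (hij : i ≠ j)
    (h : edgeIdeal K i j 1 ≤ edgeIdeal K u v 1) : edgeIdeal K i j 1 = edgeIdeal K u v 1 := by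
  have hi := X_mem_edgeIdeal.mp (h (X_mem_edgeIdeal.mpr (.inl rfl)))
  have hj := X_mem_edgeIdeal.mp (h (X_mem_edgeIdeal.mpr (.inr rfl)))
  rcases hi with rfl | rfl <;> rcases hj with rfl | rfl
  · exact absurd rfl hij
  · rfl
  · exact edgeIdeal_comm _ _ _
  · exact absurd rfl hij

/-- Multiplication by `x ^ b` shifts exponents by `b`, after which only the edge `ij` still imposes
a condition: one more unit on `i` or `j`. -/
theorem multiCoverIdeal_colon_monomial [Fintype V] {i j : V} (hij : G.Adj i j) {k : ℕ}
    {b : V →₀ ℕ} (htight : b i + b j + 1 = k)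
    (hb : ∀ u v, G.Adj u v → s(u, v) ≠ s(i, j) → k ≤ b u + b v) :
    (G.multiCoverIdeal K k).colon {monomial b 1} = edgeIdeal K i j 1 := by
  classical
  ext f
  rw [Submodule.mem_colon_singleton, smul_eq_mul, mem_multiCoverIdeal, mem_edgeIdeal]
  have hsupp : (f * monomial b 1).support = f.support.map (addRightEmbedding b) := by
    ext c
    rw [mem_support_iff, coeff_mul_monomial', Finset.mem_map]
    constructor
    · intro hc
      split_ifs at hc with hbc
      · exact ⟨c - b, by simpa using hc, tsub_add_cancel_of_le hbc⟩
      · exact absurd rfl hc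
    · rintro ⟨a, ha, rfl⟩
      simpa using ha
  rw [hsupp]
  simp only [Finset.mem_map, forall_exists_index, and_imp, forall_apply_eq_imp_iff₂,
    addRightEmbedding_apply]
  refine forall₂_congr fun a _ => ⟨fun h => ?_, fun h u v huv => ?_⟩
  · have := h hij
    simp only [Finsupp.add_apply] at this
    omega
  · simp only [Finsupp.add_apply]
    by_cases he : s(u, v) = s(i, j)
    · rcases Sym2.eq_iff.mp he with ⟨rfl, rfl⟩ | ⟨rfl, rfl⟩ <;> omega
    · have := hb u v huv he
      omega

/-- There is an exponent vector of bounded degree that is a `k`-cover except for a deficiency `1`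
on the edge `ij`. -/
theorem exists_tight [Fintype V] {i j : V} (hij : G.Adj i j) {k : ℕ} (hk : 1 ≤ k) :
    ∃ b : V →₀ ℕ, b.degree ≤ Fintype.card V * k ∧ b i + b j + 1 = k ∧
      ∀ u v, G.Adj u v → s(u, v) ≠ s(i, j) → k ≤ b u + b v := by
  classical
  -- Every edge other than `ij` has an end outside `{i, j}`, where the value is already `k`.
  refine ⟨Finsupp.equivFunOnFinite.symm fun l => if l = i then 0 else if l = j then k - 1 else k,
    ?_, ?_, fun u v huv hne => ?_⟩
  · rw [Finsupp.degree_eq_sum]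
    refine (Finset.sum_le_card_nsmul _ _ k fun l _ => ?_).trans (by simp)
    simp only [Finsupp.equivFunOnFinite_symm_apply_apply]
    split_ifs <;> omega
  · simp [hij.ne']
    omega
  · have := huv.ne
    rw [Ne, Sym2.eq_iff] at hne
    simp only [Finsupp.equivFunOnFinite_symm_apply_apply]
    split_ifs <;> grind

/-! ### Associated primes and symbolic powers -/

theorem mem_associatedPrimes_coverIdeal_iff [Fintype V] {P : Ideal (MvPolynomial V K)} :
    P ∈ associatedPrimes (MvPolynomial V K) (MvPolynomial V K ⧸ G.coverIdeal K) ↔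
      ∃ i j, G.Adj i j ∧ P = edgeIdeal K i j 1 := by
  rw [Ideal.mem_associatedPrimes_quotient_iff]
  constructor
  · rintro ⟨hP, f, rfl⟩
    have hf : f ∉ G.coverIdeal K := fun hf =>
      hP.ne_top ((Ideal.eq_top_iff_one _).mpr (Submodule.mem_colon_singleton.mpr (by simpa)))
    have hle : G.coverIdeal K ≤ (G.coverIdeal K).colon {f} := fun r hr =>
      Submodule.mem_colon_singleton.mpr (Ideal.mul_mem_right _ _ hr)
    obtain ⟨i, j, hij, hijP⟩ := exists_adj_edgeIdeal_one_le hP hle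
    rw [coverIdeal_eq_multiCoverIdeal_one, mem_multiCoverIdeal_iff_forall_adj] at hf
    push Not at hf
    obtain ⟨u, v, huv, hfuv⟩ := hf
    have hPuv : (G.coverIdeal K).colon {f} ≤ edgeIdeal K u v 1 := fun r hr => by
      rw [Submodule.mem_colon_singleton, coverIdeal_eq_multiCoverIdeal_one] at hr
      exact mem_of_mul_mem_edgeIdeal hfuv (mul_comm f r ▸ multiCoverIdeal_le huv 1 hr)
    -- The colon is squeezed between two edge primes, which must coincide.
    refine ⟨u, v, huv, hPuv.antisymm ?_⟩
    rwa [← edgeIdeal_one_eq_of_le hij.ne (hijP.trans hPuv)]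
  · rintro ⟨i, j, hij, rfl⟩
    obtain ⟨b, -, hb, hb'⟩ := exists_tight hij le_rfl
    refine ⟨isPrime_edgeIdeal_one i j, monomial b 1, ?_⟩
    rw [coverIdeal_eq_multiCoverIdeal_one, multiCoverIdeal_colon_monomial hij hb hb']

theorem mem_minimalPrimes_coverIdeal_iff [Fintype V] {P : Ideal (MvPolynomial V K)} :
    P ∈ (G.coverIdeal K).minimalPrimes ↔ ∃ i j, G.Adj i j ∧ P = edgeIdeal K i j 1 := by
  have hle {i j : V} (hij : G.Adj i j) : G.coverIdeal K ≤ edgeIdeal K i j 1 :=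
    coverIdeal_eq_multiCoverIdeal_one.trans_le (multiCoverIdeal_le hij 1)
  constructor
  · rintro ⟨⟨hP, hJP⟩, hmin⟩
    obtain ⟨i, j, hij, hijP⟩ := exists_adj_edgeIdeal_one_le hP hJP
    exact ⟨i, j, hij, (hmin ⟨isPrime_edgeIdeal_one i j, hle hij⟩ hijP).antisymm hijP⟩
  · rintro ⟨i, j, hij, rfl⟩
    refine ⟨⟨isPrime_edgeIdeal_one i j, hle hij⟩, fun Q ⟨hQ, hJQ⟩ hQP => ?_⟩
    obtain ⟨u, v, huv, huvQ⟩ := exists_adj_edgeIdeal_one_le hQ hJQ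
    rwa [← edgeIdeal_one_eq_of_le huv.ne (huvQ.trans hQP)]

theorem comap_map_coverIdeal_pow [Fintype V] {i j : V} (hij : G.Adj i j)
    (P : Ideal (MvPolynomial V K)) [hprime : P.IsPrime] (hP : P = edgeIdeal K i j 1) (k : ℕ) :
    ((G.coverIdeal K ^ k).map (algebraMap _ (Localization.AtPrime P))).comap
      (algebraMap _ (Localization.AtPrime P)) = edgeIdeal K i j k := by
  classical
  refine le_antisymm (fun f hf => ?_) fun f hf => mem_of_forall_monomial_mem fun a ha => ?_
  · rw [Ideal.mem_comap,
      IsLocalization.algebraMap_mem_map_algebraMap_iff P.primeCompl] at hf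
    obtain ⟨s, hs, hsf⟩ := hf
    refine mem_of_mul_mem_edgeIdeal (fun h => hs (hP ▸ h)) (edgeIdeal_one_pow_le i j k ?_)
    refine Ideal.pow_right_mono ?_ k hsf
    exact coverIdeal_eq_multiCoverIdeal_one.trans_le (multiCoverIdeal_le hij 1)
  · have key (l m : V) (hlm : G.Adj l m) (hPlm : P = edgeIdeal K l m 1) :
        algebraMap _ (Localization.AtPrime P) (X l : MvPolynomial V K) ∈
          (G.coverIdeal K).map (algebraMap _ (Localization.AtPrime P)) := by
      rw [IsLocalization.algebraMap_mem_map_algebraMap_iff P.primeCompl]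
      -- This product is a unit in the localization; times `x_l` it is the monomial of the vertex
      -- cover `V \ {m}`.
      refine ⟨∏ u ∈ {l, m}ᶜ, X u, fun hmem => ?_, ?_⟩
      · obtain ⟨u, hu, huP⟩ := hprime.prod_mem_iff.mp hmem
        rw [hPlm, X_mem_edgeIdeal] at huP
        simp at hu
        tauto
      · rw [mul_comm, ← Finset.prod_insert (by simp)]
        refine prod_X_mem_coverIdeal fun u v huv => ?_
        have := huv.ne
        simp only [Finset.coe_insert, Finset.coe_compl, Finset.coe_singleton, Set.mem_insert_iff,
          Set.mem_compl_iff, Set.mem_singleton_iff]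
        grind
    rw [Ideal.mem_comap, Ideal.map_pow]
    exact monomial_mem_pow_of_X_mem _ hij.ne (key i j hij hP)
      (key j i hij.symm (hP.trans (edgeIdeal_comm i j 1))) (mem_edgeIdeal.mp hf a ha)

theorem symbolicPowerAss_coverIdeal [Fintype V] (k : ℕ) :
    (G.coverIdeal K).symbolicPowerAss k = G.multiCoverIdeal K k := by
  refine le_antisymm (le_iInf fun i => le_iInf fun j => le_iInf fun hij => ?_)
    (le_iInf fun P => le_iInf fun hP => ?_)
  · refine (iInf₂_le (⟨edgeIdeal K i j 1, isPrime_edgeIdeal_one i j⟩ : PrimeSpectrum _)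
      (mem_associatedPrimes_coverIdeal_iff.mpr ⟨i, j, hij, rfl⟩)).trans_eq ?_
    have := isPrime_edgeIdeal_one (K := K) i j
    exact comap_map_coverIdeal_pow hij _ rfl k
  · obtain ⟨i, j, hij, hPij⟩ := mem_associatedPrimes_coverIdeal_iff.mp hP
    exact (multiCoverIdeal_le hij k).trans_eq (comap_map_coverIdeal_pow hij _ hPij k).symm

theorem symbolicPowerMin_coverIdeal [Fintype V] (k : ℕ) :
    (G.coverIdeal K).symbolicPowerMin k = G.multiCoverIdeal K k := by
  rw [← symbolicPowerAss_coverIdeal, Ideal.symbolicPowerMin, Ideal.symbolicPowerAss]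
  simp only [mem_minimalPrimes_coverIdeal_iff, mem_associatedPrimes_coverIdeal_iff]

/-! ### Degrees of multicovers -/

theorem initialDegree_multiCoverIdeal [Fintype V] (k : ℕ) :
    initialDegree (G.multiCoverIdeal K k) = sInf {d | ∃ a, G.IsMultiCover k a ∧ a.degree = d} := by
  classical
  rw [initialDegree]
  congr 1
  ext d
  constructor
  · rintro ⟨f, hf, hf0, hfd⟩
    obtain ⟨a, ha⟩ := support_nonempty.mpr hf0
    exact ⟨a, mem_multiCoverIdeal.mp hf a ha, by
      rw [Finsupp.degree_eq_weight_one]; exact hfd (mem_support_iff.mp ha)⟩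
  · rintro ⟨a, ha, rfl⟩
    exact ⟨monomial a 1, monomial_mem_multiCoverIdeal.mpr ha, by simp,
      isHomogeneous_monomial _ rfl⟩

theorem isMultiCover_const [Fintype V] (G : SimpleGraph V) (k : ℕ) :
    G.IsMultiCover k (Finsupp.equivFunOnFinite.symm fun _ => k) := fun i j _ => by simp

theorem exists_isMultiCover_degree_eq [Fintype V] (K : Type*) [Field K] (G : SimpleGraph V)
    (k : ℕ) : ∃ a, G.IsMultiCover k a ∧ a.degree = initialDegree (G.multiCoverIdeal K k) := by
  rw [initialDegree_multiCoverIdeal]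
  exact Nat.sInf_mem (s := {d | ∃ a, G.IsMultiCover k a ∧ a.degree = d})
    ⟨_, _, isMultiCover_const G k, rfl⟩

theorem IsMultiCover.initialDegree_le [Fintype V] (K : Type*) [Field K] {k : ℕ} {a : V →₀ ℕ}
    (ha : G.IsMultiCover k a) : initialDegree (G.multiCoverIdeal K k) ≤ a.degree := by
  rw [initialDegree_multiCoverIdeal]
  exact Nat.sInf_le ⟨a, ha, rfl⟩

/-- The degree bound holds because a `2m`-cover is the sum of `m` many `2`-covers. -/
theorem IsMultiCover.mul_initialDegree_le [Fintype V] (K : Type*) [Field K] (m : ℕ) {a : V →₀ ℕ}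
    (ha : G.IsMultiCover (2 * m) a) :
    m * initialDegree (G.multiCoverIdeal K 2) ≤ a.degree := by
  induction m generalizing a with
  | zero => simp
  | succ m ih =>
    -- A zero of `a` forces the value at each neighbour to be at least `2 * (m + 1)`, hence `b = 2`
    -- there. Where `b = 2`, the remainder is still at least `2 * m`.
    let b : V →₀ ℕ := Finsupp.equivFunOnFinite.symm fun l =>
      if a l = 0 then 0 else if a l < 2 * (m + 1) then 1 else 2
    have hbl (l : V) : b l = if a l = 0 then 0 else if a l < 2 * (m + 1) then 1 else 2 := rfl
    have hba : b ≤ a := fun l => by rw [hbl]; split_ifs <;> omega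
    have hb : G.IsMultiCover 2 b := fun i j hij => by
      have := ha hij
      rw [hbl, hbl]
      split_ifs <;> omega
    have hab : G.IsMultiCover (2 * m) (a - b) := fun i j hij => by
      have := ha hij
      rw [Finsupp.tsub_apply, Finsupp.tsub_apply, hbl, hbl]
      split_ifs <;> omega
    have hdeg : a.degree = (a - b).degree + b.degree := by
      rw [← map_add, tsub_add_cancel_of_le hba]
    rw [hdeg, add_mul, one_mul]
    exact add_le_add (ih hab) (hb.initialDegree_le K)

/-- Doubling a `k`-cover gives a `2k`-cover, so odd `k` needs no separate treatment. -/
theorem mul_initialDegree_two_le [Fintype V] (K : Type*) [Field K] (G : SimpleGraph V) (k : ℕ) :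
    k * initialDegree (G.multiCoverIdeal K 2) ≤ 2 * initialDegree (G.multiCoverIdeal K k) := by
  obtain ⟨a, ha, hdeg⟩ := exists_isMultiCover_degree_eq K G k
  have h2 : G.IsMultiCover (2 * k) (2 • a) := fun i j hij => by
    have := ha hij
    simp only [Finsupp.smul_apply, smul_eq_mul]
    omega
  simpa [hdeg] using h2.mul_initialDegree_le K k

/-- If every edge had sum at least `3`, lowering a positive entry by one would contradict
minimality. -/
theorem exists_isMultiCover_two_tight [Fintype V] (K : Type*) [Field K] (hG : G ≠ ⊥) :
    ∃ a, G.IsMultiCover 2 a ∧ a.degree = initialDegree (G.multiCoverIdeal K 2) ∧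
      ∃ i j, G.Adj i j ∧ a i + a j = 2 := by
  classical
  obtain ⟨a, ha, hdeg⟩ := exists_isMultiCover_degree_eq K G 2
  refine ⟨a, ha, hdeg, ?_⟩
  by_contra! hno
  obtain ⟨u, v, huv⟩ := G.ne_bot_iff_exists_adj.mp hG
  obtain ⟨l, hl⟩ : ∃ l, 1 ≤ a l := by
    by_contra! h
    have := ha huv
    have := h u
    have := h v
    omega
  have hle : Finsupp.single l 1 ≤ a := by simpa using hl
  have hcov : G.IsMultiCover 2 (a - Finsupp.single l 1) := fun i j hij => by
    have := ha hij
    have := hno i j hij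
    have := hij.ne
    simp only [Finsupp.tsub_apply, Finsupp.single_apply]
    split_ifs <;> grind
  have h1 := hcov.initialDegree_le K
  have h2 : (a - Finsupp.single l 1).degree + 1 = a.degree := by
    conv_rhs => rw [← tsub_add_cancel_of_le hle, map_add, Finsupp.degree_single]
  omega

/-! ### Bounds on the v-number and the limit -/

theorem mem_vDegrees_of_tight [Fintype V] {i j : V} (hij : G.Adj i j) {k : ℕ}
    {b : V →₀ ℕ} (htight : b i + b j + 1 = k)
    (hb : ∀ u v, G.Adj u v → s(u, v) ≠ s(i, j) → k ≤ b u + b v) :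
    b.degree ∈ vDegrees (G.multiCoverIdeal K k) := by
  have hcolon := multiCoverIdeal_colon_monomial (K := K) hij htight hb
  exact ⟨monomial b 1, isHomogeneous_monomial _ rfl, edgeIdeal K i j 1,
    Ideal.mem_associatedPrimes_quotient_iff.mpr
      ⟨isPrime_edgeIdeal_one i j, monomial b 1, hcolon.symm⟩, hcolon⟩

theorem vDegrees_multiCoverIdeal_nonempty [Fintype V] (K : Type*) [Field K] (hG : G ≠ ⊥) {k : ℕ}
    (hk : 1 ≤ k) : (vDegrees (G.multiCoverIdeal K k)).Nonempty := by
  obtain ⟨i, j, hij⟩ := G.ne_bot_iff_exists_adj.mp hG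
  obtain ⟨b, -, hb, hb'⟩ := exists_tight hij hk
  exact ⟨_, mem_vDegrees_of_tight hij hb hb'⟩

/-- The prime `I : f` contains `I`, hence a power of the product of all variables, hence some `x_l`;
then `x_l f` is a nonzero form in `I`. -/
theorem initialDegree_le_of_mem_vDegrees [Fintype V] {k d : ℕ}
    (hd : d ∈ vDegrees (G.multiCoverIdeal K k)) :
    initialDegree (G.multiCoverIdeal K k) ≤ d + 1 := by
  obtain ⟨f, hfd, P, hP, hfP⟩ := hd
  have hprime : P.IsPrime := hP.isPrime
  have hmem : monomial (Finsupp.equivFunOnFinite.symm fun _ => k) 1 ∈ P := by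
    rw [← hfP, Submodule.mem_colon_singleton]
    exact Ideal.mul_mem_right _ _ (monomial_mem_multiCoverIdeal.mpr (isMultiCover_const G k))
  rw [monomial_eq, map_one, one_mul, Finsupp.prod_fintype _ _ (by simp),
    hprime.prod_mem_iff] at hmem
  obtain ⟨l, -, hl⟩ := hmem
  have hX := hprime.mem_of_pow_mem _ hl
  rw [← hfP, Submodule.mem_colon_singleton, smul_eq_mul] at hX
  have hf0 : f ≠ 0 := by
    rintro rfl
    exact hprime.ne_top ((Ideal.eq_top_iff_one _).mpr
      (hfP ▸ Submodule.mem_colon_singleton.mpr (by simp)))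
  exact Nat.sInf_le ⟨_, hX, mul_ne_zero (X_ne_zero l) hf0,
    by simpa [add_comm] using (isHomogeneous_X K l).mul hfd⟩

theorem le_two_mul_vNumber [Fintype V] (K : Type*) [Field K] (hG : G ≠ ⊥) {k : ℕ} (hk : 1 ≤ k) :
    k * initialDegree (G.multiCoverIdeal K 2) ≤ 2 * (vNumber (G.multiCoverIdeal K k) + 1) :=
  (mul_initialDegree_two_le K G k).trans <| Nat.mul_le_mul_left 2 <|
    initialDegree_le_of_mem_vDegrees (Nat.sInf_mem (vDegrees_multiCoverIdeal_nonempty K hG hk))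

theorem two_mul_vNumber_le [Fintype V] (K : Type*) [Field K] (hG : G ≠ ⊥) {k : ℕ} (hk : 1 ≤ k) :
    2 * vNumber (G.multiCoverIdeal K k) ≤
      k * initialDegree (G.multiCoverIdeal K 2) + 4 * Fintype.card V := by
  obtain ⟨a, ha, hdeg, i, j, hij, haij⟩ := exists_isMultiCover_two_tight K hG
  -- The remainder is taken in `{1, 2}`, not `{0, 1}`, since a deficiency of one needs `r ≥ 1`. The
  -- bound `r ≤ 2` yields the error `4n`.
  obtain ⟨m, r, rfl, hr1, hr2⟩ : ∃ m r, k = 2 * m + r ∧ 1 ≤ r ∧ r ≤ 2 :=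
    ⟨(k - 1) / 2, k - 2 * ((k - 1) / 2), by omega, by omega, by omega⟩
  obtain ⟨b, hbdeg, hb, hb'⟩ := exists_tight hij hr1
  have hv : (m • a + b).degree ∈ vDegrees (G.multiCoverIdeal K (2 * m + r)) := by
    refine mem_vDegrees_of_tight hij ?_ fun u v huv hne => ?_
    · simp only [Finsupp.add_apply, Finsupp.smul_apply, smul_eq_mul]
      linear_combination m * haij + hb
    · have h1 := hb' u v huv hne
      have h2 := Nat.mul_le_mul_left m (ha huv)
      simp only [Finsupp.add_apply, Finsupp.smul_apply, smul_eq_mul]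
      linarith
  have hle : vNumber (G.multiCoverIdeal K (2 * m + r)) ≤ (m • a + b).degree := Nat.sInf_le hv
  rw [map_add, map_nsmul, hdeg, smul_eq_mul] at hle
  have := Nat.mul_le_mul_left (Fintype.card V) hr2
  nlinarith [Nat.zero_le (r * initialDegree (G.multiCoverIdeal K 2))]

theorem tendsto_vNumber_multiCoverIdeal_div [Fintype V] (K : Type*) [Field K]
    (G : SimpleGraph V) :
    Tendsto (fun k : ℕ => (vNumber (G.multiCoverIdeal K k) : ℝ) / (k : ℝ)) atTop
      (𝓝 ((initialDegree (G.multiCoverIdeal K 2) : ℝ) / 2)) := by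
  -- Without edges all the ideals are the unit ideal, and the convention `v(R) = 0` gives the limit
  -- `0`.
  by_cases hG : G = ⊥
  · subst hG
    have htop (k : ℕ) : (⊥ : SimpleGraph V).multiCoverIdeal K k = ⊤ := by
      simp [multiCoverIdeal]
    have hv : vNumber (⊤ : Ideal (MvPolynomial V K)) = 0 := by
      refine Nat.sInf_eq_zero.mpr (.inr (Set.eq_empty_of_forall_notMem ?_))
      rintro d ⟨f, -, P, hP, rfl⟩
      exact hP.isPrime.ne_top ((Ideal.eq_top_iff_one _).mpr
        (Submodule.mem_colon_singleton.mpr trivial))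
    have hα : initialDegree (⊤ : Ideal (MvPolynomial V K)) = 0 :=
      Nat.sInf_eq_zero.mpr (.inl ⟨1, trivial, one_ne_zero, isHomogeneous_one V K⟩)
    simp [htop, hv, hα]
  · set α := initialDegree (G.multiCoverIdeal K 2)
    have hlim (c : ℝ) : Tendsto (fun k : ℕ => (α : ℝ) / 2 + c / (k : ℝ)) atTop
        (𝓝 ((α : ℝ) / 2)) := by
      simpa using (tendsto_const_div_atTop_nhds_zero_nat c).const_add ((α : ℝ) / 2)
    refine tendsto_of_tendsto_of_tendsto_of_le_of_le' (hlim (-1)) (hlim (2 * Fintype.card V)) ?_ ?_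
    · filter_upwards [eventually_ge_atTop 1] with k hk
      have hk0 : (0 : ℝ) < k := by exact_mod_cast hk
      have h : (k : ℝ) * α ≤ 2 * (vNumber (G.multiCoverIdeal K k) + 1) := by
        exact_mod_cast le_two_mul_vNumber K hG hk
      rw [le_div_iff₀ hk0, add_mul, div_mul_cancel₀ _ hk0.ne']
      linarith
    · filter_upwards [eventually_ge_atTop 1] with k hk
      have hk0 : (0 : ℝ) < k := by exact_mod_cast hk
      have h : 2 * (vNumber (G.multiCoverIdeal K k) : ℝ) ≤ k * α + 4 * Fintype.card V := by
        exact_mod_cast two_mul_vNumber_le K hG hk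
      rw [div_le_iff₀ hk0, add_mul, div_mul_cancel₀ _ hk0.ne']
      linarith

end SimpleGraph

theorem proposition5p5 {V : Type*} [Fintype V] (K : Type*) [Field K] (G : SimpleGraph V) :
    Tendsto (fun k : ℕ =>
        (MvPolynomial.vNumber ((G.coverIdeal K).symbolicPowerAss k) : ℝ) / (k : ℝ)) atTop
      (𝓝 ((MvPolynomial.initialDegree ((G.coverIdeal K).symbolicPowerAss 2) : ℝ) / 2)) ∧
    Tendsto (fun k : ℕ =>
        (MvPolynomial.vNumber ((G.coverIdeal K).symbolicPowerMin k) : ℝ) / (k : ℝ)) atTop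
      (𝓝 ((MvPolynomial.initialDegree ((G.coverIdeal K).symbolicPowerMin 2) : ℝ) / 2)) ∧
    -- if `G` has an edge, the v-numbers above are genuine minima
    (G ≠ ⊥ → ∀ k : ℕ, 1 ≤ k →
      (MvPolynomial.vDegrees ((G.coverIdeal K).symbolicPowerAss k)).Nonempty ∧
      (MvPolynomial.vDegrees ((G.coverIdeal K).symbolicPowerMin k)).Nonempty) := by
  simp only [SimpleGraph.symbolicPowerAss_coverIdeal, SimpleGraph.symbolicPowerMin_coverIdeal]
  exact ⟨SimpleGraph.tendsto_vNumber_multiCoverIdeal_div K G,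
    SimpleGraph.tendsto_vNumber_multiCoverIdeal_div K G, fun hG k hk =>
      ⟨SimpleGraph.vDegrees_multiCoverIdeal_nonempty K hG hk,
        SimpleGraph.vDegrees_multiCoverIdeal_nonempty K hG hk⟩⟩
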